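/- Let $N$ and $d$ be nonnegative integers. Call cones $\sigma,\sigma'\subset\mathbb R^d$ equivalent if some linear automorphism of $\mathbb R^d$ that maps $\mathbb Z^d$ onto $\mathbb Z^d$ maps $\sigma$ onto $\sigma'$. For a pointed rational polyhedral cone $\sigma\subset\mathbb R^d$ let $v_1,\dots,v_r$ be its primitive generators, i.e. the primitive lattice vectors on its rays; $\sigma$ is called $\mathbb Q$-Gorenstein if there is a linear functional taking the value $1$ on all $v_i$ (equivalently, for $\sigma\ne\{0\}$, the $v_i$ lie in an affine hyperplane of the linear span of $\sigma$). Let $\operatorname{nib}(\sigma)=\operatorname{conv}(0,v_1,\dots,v_r)$, and let the Hilbert basis $\mathcal H(\sigma)$ be the unique minimal set of generators of the semigroup $\sigma\cap\mathbb Z^d$. Then, up to equivalence, there are only finitely many $\mathbb Q$-Gorenstein cones $\sigma\subset\mathbb R^d$ (of any dimension) with $$\#\mathcal H(\sigma)+\#\bigl(\operatorname{nib}(\sigma)\cap\mathbb Z^d\bigr)\le N+1 .$$ -/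

import Mathlib

namespace LatticeCone

/-- The lattice `ℤ^d` inside `ℝ^d`. -/
def integerLattice (d : ℕ) : AddSubgroup (Fin d → ℝ) :=
  ((Int.castAddHom ℝ).compLeft (Fin d)).range

/-- A lattice vector is primitive if it is nonzero and not a proper multiple of another
lattice vector. -/
def IsPrimitive {d : ℕ} (v : Fin d → ℝ) : Prop :=
  v ∈ integerLattice d ∧ v ≠ 0 ∧
    ∀ w ∈ integerLattice d, ∀ k : ℕ, v = k • w → k = 1

/-- A pointed (strongly convex) rational polyhedral cone in `ℝ^d`, of any dimension: it is
generated by finitely many lattice vectors and contains no line. (Mathlib's `PointedCone` is a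
convex cone which contains `0`; "pointed" in the geometric sense is `Salient`.) -/
def IsPointedRational {d : ℕ} (σ : PointedCone ℝ (Fin d → ℝ)) : Prop :=
  (∃ s : Finset (Fin d → ℝ), (s : Set (Fin d → ℝ)) ⊆ integerLattice d ∧
    PointedCone.hull ℝ (s : Set (Fin d → ℝ)) = σ) ∧
  (σ : ConvexCone ℝ (Fin d → ℝ)).Salient

/-- The primitive generators `v₁, …, v_r` of `σ`: the primitive lattice vectors on the
one-dimensional faces (rays) of `σ`. -/
def primitiveGenerators {d : ℕ} (σ : PointedCone ℝ (Fin d → ℝ)) : Set (Fin d → ℝ) :=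
  {v | IsPrimitive v ∧ (PointedCone.hull ℝ {v}).IsFaceOf σ}

/-- `σ` is a `ℚ`-Gorenstein cone: a pointed rational cone whose primitive generators lie in an
affine hyperplane of its linear span. As they span the latter, the hyperplane does not contain
the origin, and so is the level set at height `1` of a linear functional. -/
def IsQGorenstein {d : ℕ} (σ : PointedCone ℝ (Fin d → ℝ)) : Prop :=
  IsPointedRational σ ∧
    ∃ height : (Fin d → ℝ) →ₗ[ℝ] ℝ, ∀ v ∈ primitiveGenerators σ, height v = 1

/-- The nib of `σ`: the convex hull of the origin and the primitive generators. -/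
def nib {d : ℕ} (σ : PointedCone ℝ (Fin d → ℝ)) : Set (Fin d → ℝ) :=
  convexHull ℝ (insert 0 (primitiveGenerators σ))

/-- The semigroup `σ ∩ ℤ^d` (with zero). -/
def latticeMonoid {d : ℕ} (σ : PointedCone ℝ (Fin d → ℝ)) : AddSubmonoid (Fin d → ℝ) :=
  σ.toAddSubmonoid ⊓ (integerLattice d).toAddSubmonoid

/-- The Hilbert basis of `σ`: the nonzero elements of `σ ∩ ℤ^d` which are not a sum of two
nonzero elements of `σ ∩ ℤ^d`. By `eq_hilbertBasis_of_minimal` it is the only candidate for a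
minimal set of generators of this semigroup. -/
def hilbertBasis {d : ℕ} (σ : PointedCone ℝ (Fin d → ℝ)) : Set (Fin d → ℝ) :=
  {x | x ∈ latticeMonoid σ ∧ x ≠ 0 ∧
    ∀ y ∈ latticeMonoid σ, ∀ z ∈ latticeMonoid σ, x = y + z → y = 0 ∨ z = 0}

/-- Two cones in `ℝ^d` are (integrally) equivalent if a linear automorphism of `ℝ^d` which maps
`ℤ^d` onto itself maps the one onto the other. -/
def IntegrallyEquivalent {d : ℕ} (σ τ : PointedCone ℝ (Fin d → ℝ)) : Prop :=
  ∃ e : (Fin d → ℝ) ≃ₗ[ℝ] (Fin d → ℝ),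
    e '' (integerLattice d : Set (Fin d → ℝ)) = integerLattice d ∧
    e '' (σ : Set (Fin d → ℝ)) = τ

/-- The Hilbert basis is contained in every set of generators of `σ ∩ ℤ^d`. -/
theorem hilbertBasis_subset {d : ℕ} {σ : PointedCone ℝ (Fin d → ℝ)} {G : Set (Fin d → ℝ)}
    (hG : AddSubmonoid.closure G = latticeMonoid σ) : hilbertBasis σ ⊆ G := by
  intro x hx
  have h : ∀ y (_ : y ∈ AddSubmonoid.closure G), y ∈ hilbertBasis σ → y ∈ G := by
    intro y hy
    induction hy using AddSubmonoid.closure_induction with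
    | mem y hy => exact fun _ => hy
    | zero => exact fun h0 => absurd rfl h0.2.1
    | add y z hy hz ihy ihz =>
      intro h
      rcases h.2.2 y (hG ▸ hy) z (hG ▸ hz) rfl with h0 | h0
      · subst h0; rw [zero_add] at h ⊢; exact ihz h
      · subst h0; rw [add_zero] at h ⊢; exact ihy h
  exact h x (hG ▸ hx.1) hx

/-- Any minimal set of generators of `σ ∩ ℤ^d` is the Hilbert basis, if `σ` is pointed. -/
theorem eq_hilbertBasis_of_minimal {d : ℕ} {σ : PointedCone ℝ (Fin d → ℝ)}
    (hσ : (σ : ConvexCone ℝ (Fin d → ℝ)).Salient) {G : Set (Fin d → ℝ)}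
    (hG : Minimal (fun H => AddSubmonoid.closure H = latticeMonoid σ) G) :
    G = hilbertBasis σ := by
  have hcl : AddSubmonoid.closure G = latticeMonoid σ := hG.prop
  refine Set.Subset.antisymm (fun g hg => ?_) (hilbertBasis_subset hcl)
  have hnot : g ∉ AddSubmonoid.closure (G \ {g}) := by
    intro hmem
    have hle : AddSubmonoid.closure (G \ {g}) = latticeMonoid σ := by
      rw [← hcl]
      refine le_antisymm (AddSubmonoid.closure_mono Set.sdiff_subset) ?_
      rw [AddSubmonoid.closure_le]
      intro x hx
      by_cases hxg : x = g
      · subst hxg; exact hmem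
      · exact AddSubmonoid.subset_closure ⟨hx, hxg⟩
    exact (hG.le_of_le hle Set.sdiff_subset hg).2 rfl
  have hsplit : ∀ y (_ : y ∈ AddSubmonoid.closure G),
      y ∈ AddSubmonoid.closure (G \ {g}) ∨ ∃ y' ∈ latticeMonoid σ, y = g + y' := by
    intro y hy
    induction hy using AddSubmonoid.closure_induction with
    | mem y hy =>
      by_cases hyg : y = g
      · exact Or.inr ⟨0, zero_mem _, by simp [hyg]⟩
      · exact Or.inl (AddSubmonoid.subset_closure ⟨hy, hyg⟩)
    | zero => exact Or.inl (zero_mem _)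
    | add y z hy hz ihy ihz =>
      rcases ihy with hy1 | ⟨y', hy', rfl⟩
      · rcases ihz with hz1 | ⟨z', hz', rfl⟩
        · exact Or.inl (add_mem hy1 hz1)
        · exact Or.inr ⟨y + z', add_mem (hcl ▸ hy) hz', by abel⟩
      · exact Or.inr ⟨y' + z, add_mem hy' (hcl ▸ hz), by abel⟩
  have hpointed : ∀ y ∈ latticeMonoid σ, ∀ z ∈ latticeMonoid σ, g = g + y + z → z = 0 := by
    intro y hy z hz h
    by_contra hz0
    refine hσ z hz.1 hz0 ?_
    have : -z = y := by
      have h' : y + z = 0 := by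
        rw [add_assoc] at h
        exact left_eq_add.mp h
      exact (eq_neg_of_add_eq_zero_left h').symm
    rw [this]
    exact hy.1
  refine ⟨hcl ▸ AddSubmonoid.subset_closure hg, ?_, ?_⟩
  · intro h0
    exact hnot (h0 ▸ zero_mem _)
  · intro y hy z hz h
    by_contra hne
    push Not at hne
    rcases hsplit y (hcl ▸ hy) with hy1 | ⟨y', hy', rfl⟩
    · rcases hsplit z (hcl ▸ hz) with hz1 | ⟨z', hz', rfl⟩
      · have hs := add_mem hy1 hz1
        rw [← h] at hs
        exact hnot hs
      · exact hne.1 (hpointed z' hz' y hy (h.trans (add_comm _ _)))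
    · exact hne.2 (hpointed y' hy' z hz h)

end LatticeCone

/-!
A multiple of the functional taking the value `1` on the primitive generators is a height function
with values in a fixed interval `[1, D]` on the Hilbert basis. A nonzero lattice point of small
height would have too many multiples in the nib, which gives the lower bound. A point with a
coefficient larger than `1` at some primitive generator remains in the cone after subtracting it, so
the height of an indecomposable point is at most the number of primitive generators.

The linear relations between the elements of the Hilbert basis determine the cone up to equivalence:
the subgroup they generate is saturated in `ℤ^d`, so an isomorphism of two such subgroups extends to
an automorphism of `ℤ^d`. It remains to bound the relations. The space of real relations is spanned
by its elementary vectors. If `c` is one of these, scaled to maximal coefficient `1`, then for each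
`k` the lattice point `-∑ ⌊k c i⌋ u i = ∑ fract (k c i) u i` of the cone is a combination of the
`u i` with natural coefficients, bounded by its height. Hence two values of `k` below a uniform
bound give the same combination, and the difference of the corresponding vectors `⌊k c⌋` is an
integer relation with bounded coefficients, which is proportional to `c` by minimality of the
support.
-/

namespace LatticeCone

open PointedCone

section ElementaryVector

variable {𝕜 ι : Type*} [Field 𝕜] {K : Submodule 𝕜 (ι → 𝕜)} {c x : ι → 𝕜}

/-- The elementary vectors of a subspace `K` of `𝕜^ι`, in Rockafellar's sense: the nonzero
elements of `K` whose support is minimal. -/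
def IsElementaryVector (K : Submodule 𝕜 (ι → 𝕜)) (c : ι → 𝕜) : Prop :=
  MinimalFor (fun x => x ∈ K ∧ x ≠ 0) Function.support c

theorem IsElementaryVector.eq_smul (hc : IsElementaryVector K c) (hx : x ∈ K)
    (hxc : Function.support x ⊆ Function.support c) {i : ι} (hi : c i ≠ 0) :
    x = (x i / c i) • c := by
  by_contra hne
  set y := x - (x i / c i) • c with hy
  have hyK : y ∈ K ∧ y ≠ 0 := ⟨sub_mem hx (K.smul_mem _ hc.1.1), sub_ne_zero.2 hne⟩
  have hyc : Function.support y ⊆ Function.support c := fun k hk hck =>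
    hk (by simp [hy, hck, Function.notMem_support.1 fun h => hxc h hck])
  exact hc.2 hyK hyc hi (by simp [hy, hi])

variable [Finite ι]

theorem exists_isElementaryVector_support_subset (hx : x ∈ K) (hx0 : x ≠ 0) :
    ∃ c, IsElementaryVector K c ∧ Function.support c ⊆ Function.support x := by
  obtain ⟨c, ⟨hc, hcx⟩, hmin⟩ := exists_minimalFor_of_wellFoundedLT
    (fun y => (y ∈ K ∧ y ≠ 0) ∧ Function.support y ⊆ Function.support x) Function.support
    ⟨x, ⟨hx, hx0⟩, subset_rfl⟩
  exact ⟨c, ⟨hc, fun y hy hyc => hmin ⟨hy, hyc.trans hcx⟩ hyc⟩, hcx⟩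

theorem mem_span_isElementaryVector (hx : x ∈ K) :
    x ∈ Submodule.span 𝕜 {c | IsElementaryVector K c} := by
  induction hs : Function.support x using WellFoundedLT.induction generalizing x with
  | _ s ih =>
    subst hs
    rcases eq_or_ne x 0 with rfl | hx0
    · exact zero_mem _
    obtain ⟨c, hc, hcx⟩ := exists_isElementaryVector_support_subset hx hx0
    obtain ⟨i, hi⟩ := Function.ne_iff.1 hc.1.2
    set y := x - (x i / c i) • c with hy
    have hyx : Function.support y ⊂ Function.support x := by
      refine ⟨fun k hk hxk => hk ?_, fun h => h (hcx hi) (by simp [hy, div_mul_cancel₀ _ hi])⟩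
      simp [hy, hxk, Function.notMem_support.1 fun h => hcx h hxk]
    have hy_mem := ih _ hyx (sub_mem hx (K.smul_mem _ hc.1.1)) rfl
    rw [← sub_add_cancel x ((x i / c i) • c)]
    exact add_mem hy_mem (Submodule.smul_mem _ _ (Submodule.subset_span hc))

end ElementaryVector

section ConvexGeometry

variable {𝕜 E : Type*} [Field 𝕜] [LinearOrder 𝕜] [IsStrictOrderedRing 𝕜] [AddCommGroup E]
  [Module 𝕜 E]

theorem mem_hull_range_iff {ι : Type*} [Fintype ι] {v : ι → E} {x : E} :
    x ∈ hull 𝕜 (Set.range v) ↔ ∃ t : ι → 𝕜, 0 ≤ t ∧ Fintype.linearCombination 𝕜 v t = x := by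
  rw [Submodule.mem_span_range_iff_exists_fun]
  constructor
  · rintro ⟨c, rfl⟩
    exact ⟨fun i => c i, fun i => (c i).2, rfl⟩
  · rintro ⟨t, ht, rfl⟩
    exact ⟨fun i => ⟨t i, ht i⟩, rfl⟩

theorem hull_singleton_smul {c : 𝕜} (hc : 0 < c) (x : E) : hull 𝕜 {c • x} = hull 𝕜 {x} :=
  Submodule.span_singleton_smul_eq (r := (⟨c, hc.le⟩ : {r : 𝕜 // 0 ≤ r}))
    (IsUnit.mk0 _ fun h => hc.ne' (congrArg Subtype.val h)) x

theorem hull_singleton_isFaceOf_hull_insert {s : Set E} {a : E}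
    (hsal : (hull 𝕜 (insert a s) : ConvexCone 𝕜 E).Salient) (ha : a ∉ hull 𝕜 s) :
    (hull 𝕜 {a}).IsFaceOf (hull 𝕜 (insert a s)) := by
  have hle : hull 𝕜 s ≤ hull 𝕜 (insert a s) := Submodule.span_mono (Set.subset_insert _ _)
  refine .of_mem_of_add_mem_left (Submodule.span_mono (by simp)) fun {x y} hx hy hxy => ?_
  obtain ⟨⟨α, hα⟩, x', hx', rfl⟩ := Submodule.mem_span_insert.1 hx
  obtain ⟨⟨β, hβ⟩, y', hy', rfl⟩ := Submodule.mem_span_insert.1 hy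
  obtain ⟨⟨γ, hγ⟩, hc⟩ := Submodule.mem_span_singleton.1 hxy
  simp only [Nonneg.mk_smul] at hc ⊢
  rcases lt_or_ge (α + β) γ with hlt | hge
  · have hmem : (γ - (α + β)) • a ∈ hull 𝕜 s := by
      rw [show (γ - (α + β)) • a = x' + y' by rw [sub_smul, hc]; module]
      exact add_mem hx' hy'
    exact absurd ((smul_mem_iff _ (sub_pos.2 hlt)).1 hmem) ha
  · suffices x' = 0 by
      rw [this, add_zero]
      exact smul_mem _ hα (subset_hull rfl)
    by_contra hne
    refine hsal x' (hle hx') hne ?_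
    have hneg : -x' = (α + β - γ) • a + y' := by rw [sub_smul, hc]; module
    rw [hneg]
    exact add_mem (smul_mem _ (sub_nonneg.2 hge) (subset_hull (Set.mem_insert _ _))) (hle hy')

theorem exists_subset_hull_eq_and_isFaceOf {s : Set E} (hs : s.Finite)
    (hsal : (hull 𝕜 s : ConvexCone 𝕜 E).Salient) :
    ∃ t ⊆ s, hull 𝕜 t = hull 𝕜 s ∧ ∀ a ∈ t, a ≠ 0 ∧ (hull 𝕜 {a}).IsFaceOf (hull 𝕜 s) := by
  obtain ⟨t, ⟨hts, ht⟩, hmin⟩ := (hs.powerset.subset (Set.sep_subset _ _)).exists_minimal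
    (s := {t ∈ 𝒫 s | hull 𝕜 t = hull 𝕜 s}) ⟨s, Set.mem_powerset subset_rfl, rfl⟩
  refine ⟨t, hts, ht, fun a ha => ?_⟩
  have hins : insert a (t \ {a}) = t := Set.insert_sdiff_self_of_mem ha
  have hdiff (hmem : a ∈ hull 𝕜 (t \ {a})) : hull 𝕜 (t \ {a}) = hull 𝕜 s :=
    (Submodule.span_insert_eq_span hmem).symm.trans ((congrArg (hull 𝕜) hins).trans ht)
  have hnot : a ∉ hull 𝕜 (t \ {a}) := fun hmem =>
    (hmin ⟨Set.sdiff_subset.trans hts, hdiff hmem⟩ Set.sdiff_subset ha).2 rfl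
  refine ⟨fun h0 => hnot (h0 ▸ zero_mem _), ?_⟩
  rw [← ht, ← hins] at hsal ⊢
  exact hull_singleton_isFaceOf_hull_insert hsal hnot

variable {V : Set E} {ht : E →ₗ[𝕜] 𝕜} {x : E}

open scoped Pointwise in
theorem height_nonneg_and_mem_smul_convexHull (hht : ∀ v ∈ V, ht v = 1) (hx : x ∈ hull 𝕜 V) :
    0 ≤ ht x ∧ x ∈ ht x • convexHull 𝕜 (insert 0 V) := by
  have hconv : Convex 𝕜 (convexHull 𝕜 (insert 0 V)) := convex_convexHull 𝕜 _
  induction hx using Submodule.span_induction with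
  | mem v hv =>
    rw [hht v hv, one_smul]
    exact ⟨zero_le_one, subset_convexHull 𝕜 _ (Set.mem_insert_of_mem _ hv)⟩
  | zero =>
    rw [map_zero]
    exact ⟨le_rfl, 0, subset_convexHull 𝕜 _ (Set.mem_insert _ _), smul_zero _⟩
  | add x y _ _ hx hy =>
    rw [map_add, hconv.add_smul hx.1 hy.1]
    exact ⟨add_nonneg hx.1 hy.1, Set.add_mem_add hx.2 hy.2⟩
  | smul c x _ hx =>
    have hc : ht (c • x) = c * ht x := map_smul ht (c : 𝕜) x
    rw [hc, mul_smul]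
    exact ⟨mul_nonneg c.2 hx.1, Set.smul_mem_smul_set hx.2⟩

theorem height_pos_of_mem_hull (hht : ∀ v ∈ V, ht v = 1) (hx : x ∈ hull 𝕜 V) (hx0 : x ≠ 0) :
    0 < ht x := by
  obtain ⟨hnonneg, y, -, hy⟩ := height_nonneg_and_mem_smul_convexHull hht hx
  exact hnonneg.lt_of_ne' fun h0 => hx0 (by simpa [h0] using hy.symm)

theorem mem_convexHull_of_height_le_one (hht : ∀ v ∈ V, ht v = 1) (hx : x ∈ hull 𝕜 V)
    (hx1 : ht x ≤ 1) : x ∈ convexHull 𝕜 (insert 0 V) := by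
  obtain ⟨hnonneg, y, hyV, hy⟩ := height_nonneg_and_mem_smul_convexHull hht hx
  rw [← hy]
  exact (convex_convexHull 𝕜 _).smul_mem_of_zero_mem
    (subset_convexHull 𝕜 _ (Set.mem_insert _ _)) hyV ⟨hnonneg, hx1⟩

theorem height_le_card_or_exists_sub_mem_hull {ι : Type*} [Fintype ι] {v : ι → E}
    (hht : ∀ i, ht (v i) = 1) (hx : x ∈ hull 𝕜 (Set.range v)) :
    ht x ≤ Fintype.card ι ∨ ∃ i, x - v i ∈ hull 𝕜 (Set.range v) := by
  classical
  obtain ⟨t, ht0, rfl⟩ := mem_hull_range_iff.1 hx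
  by_cases hle : ∀ i, t i ≤ 1
  · left
    calc ht (Fintype.linearCombination 𝕜 v t) = ∑ i, t i := by
          simp [Fintype.linearCombination_apply, hht]
      _ ≤ ∑ _i : ι, (1 : 𝕜) := Finset.sum_le_sum fun i _ => hle i
      _ = Fintype.card ι := by simp
  · right
    obtain ⟨i, hi⟩ := not_forall.1 hle
    refine ⟨i, mem_hull_range_iff.2 ⟨t - Pi.single i 1, sub_nonneg.2 fun k => ?_, by simp⟩⟩
    rcases eq_or_ne k i with rfl | hk
    · simpa using (not_le.1 hi).le
    · simpa [hk] using ht0 k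

end ConvexGeometry

theorem closure_indecomposables {𝕜 A : Type*} [CommRing 𝕜] [LinearOrder 𝕜]
    [IsStrictOrderedRing 𝕜] [Archimedean 𝕜] [AddMonoid A] {S : AddSubmonoid A} {ht : A →+ 𝕜}
    (hht : ∀ x ∈ S, x ≠ 0 → 1 ≤ ht x) :
    AddSubmonoid.closure {x | x ∈ S ∧ x ≠ 0 ∧
      ∀ y ∈ S, ∀ z ∈ S, x = y + z → y = 0 ∨ z = 0} = S := by
  refine le_antisymm (AddSubmonoid.closure_le.2 fun x hx => hx.1) fun x hx => ?_
  obtain ⟨k, hxk⟩ := exists_nat_ge (ht x)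
  induction k generalizing x with
  | zero =>
    obtain rfl : x = 0 := by
      by_contra hx0
      exact absurd (hht x hx hx0) (by push_cast at hxk; linarith)
    exact zero_mem _
  | succ k ih =>
    by_cases hirr : x ≠ 0 ∧ ∀ y ∈ S, ∀ z ∈ S, x = y + z → y = 0 ∨ z = 0
    · exact AddSubmonoid.subset_closure ⟨hx, hirr⟩
    rcases eq_or_ne x 0 with rfl | hx0
    · exact zero_mem _
    push Not at hirr
    obtain ⟨y, hy, z, hz, rfl, hy0, hz0⟩ := hirr hx0
    rw [map_add, Nat.cast_succ] at hxk
    exact add_mem (ih y hy (by linarith [hht z hz hz0])) (ih z hz (by linarith [hht y hy hy0]))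

section ConePoints

variable {M E ι : Type*} [AddCommGroup M] [AddCommGroup E] [Module ℝ E] {f : M →ₗ[ℤ] E}
  {u : ι → M}

/-- The family `u` generates the semigroup of lattice points of the cone it spans, where the
lattice `M` is viewed in the real vector space `E` through `f`. -/
def GeneratesConePoints (f : M →ₗ[ℤ] E) (u : ι → M) : Prop :=
  ∀ x, f x ∈ hull ℝ (Set.range (f ∘ u)) → x ∈ AddSubmonoid.closure (Set.range u)

theorem linearCombination_intCast [Fintype ι] (p : ι → ℤ) :
    Fintype.linearCombination ℝ (f ∘ u) (fun i => (p i : ℝ)) =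
      f (Fintype.linearCombination ℤ u p) := by
  simp [Fintype.linearCombination_apply, Int.cast_smul_eq_zsmul]

theorem linearCombination_fract [Fintype ι] {c : ι → ℝ} {x : M}
    (hx : Fintype.linearCombination ℝ (f ∘ u) c = f x) :
    Fintype.linearCombination ℝ (f ∘ u) (fun i => Int.fract (c i)) =
      f (x - Fintype.linearCombination ℤ u fun i => ⌊c i⌋) := by
  rw [map_sub, ← hx, ← linearCombination_intCast, ← map_sub]
  rfl

theorem GeneratesConePoints.sub_floor_mem_closure [Fintype ι] (hu : GeneratesConePoints f u)
    {c : ι → ℝ} {x : M} (hx : Fintype.linearCombination ℝ (f ∘ u) c = f x) :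
    x - Fintype.linearCombination ℤ u (fun i => ⌊c i⌋) ∈ AddSubmonoid.closure (Set.range u) :=
  hu _ (mem_hull_range_iff.2 ⟨_, fun i => Int.fract_nonneg (c i), linearCombination_fract hx⟩)

theorem GeneratesConePoints.mem_span_of_smul_mem [Finite ι] (hu : GeneratesConePoints f u)
    {k : ℤ} (hk : k ≠ 0) {x : M} (hx : k • x ∈ Submodule.span ℤ (Set.range u)) :
    x ∈ Submodule.span ℤ (Set.range u) := by
  have := Fintype.ofFinite ι
  rw [← Fintype.range_linearCombination] at hx ⊢
  obtain ⟨c, hc⟩ := hx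
  have hfx : Fintype.linearCombination ℝ (f ∘ u) ((k : ℝ)⁻¹ • fun i => (c i : ℝ)) = f x := by
    rw [map_smul, linearCombination_intCast, hc, map_zsmul, ← Int.cast_smul_eq_zsmul ℝ,
      inv_smul_smul₀ (Int.cast_ne_zero.2 hk)]
  have hmem := Submodule.closure_subset_span (R := ℤ) (hu.sub_floor_mem_closure hfx)
  rw [← Fintype.range_linearCombination] at hmem
  exact (Submodule.sub_mem_iff_left _ (LinearMap.mem_range_self _ _)).1 hmem

theorem GeneratesConePoints.isTorsionFree_quotient_span [Finite ι] (hu : GeneratesConePoints f u) :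
    Module.IsTorsionFree ℤ (M ⧸ Submodule.span ℤ (Set.range u)) := by
  rw [Module.isTorsionFree_iff_smul_eq_zero]
  intro k q hq
  induction q using Submodule.Quotient.induction_on with
  | _ x =>
    rw [← Submodule.Quotient.mk_smul, Submodule.Quotient.mk_eq_zero] at hq
    rw [Submodule.Quotient.mk_eq_zero]
    exact or_iff_not_imp_left.2 fun hk => hu.mem_span_of_smul_mem hk hq

end ConePoints

section BoundedRelations

variable {M ι : Type*} [AddCommGroup M] [Fintype ι]

/-- The integer relations between the `u i` with coefficients bounded by `B`. For a family
generating the lattice points of its cone, they determine the cone up to lattice automorphism as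
soon as `B` is large enough, and there are only finitely many possibilities for this set. -/
def boundedRelations (B : ℕ) (u : ι → M) : Set (ι → ℤ) :=
  {p | (∀ i, |p i| ≤ B) ∧ Fintype.linearCombination ℤ u p = 0}

theorem finite_range_boundedRelations (B : ℕ) :
    (Set.range (boundedRelations B : (ι → M) → Set (ι → ℤ))).Finite := by
  classical
  refine (Set.finite_Icc (fun _ => -(B : ℤ)) fun _ => (B : ℤ)).powerset.subset ?_
  rintro _ ⟨u, rfl⟩ p ⟨hp, -⟩
  exact ⟨fun i => (abs_le.1 (hp i)).1, fun i => (abs_le.1 (hp i)).2⟩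

/-- The coefficient bound for which `boundedRelations` spans all relations between `#ι` generators,
of heights between `1` and `D`, of the lattice points of a cone. It comes from a pigeonhole argument
on `#ι`-tuples of natural numbers at most `#ι * D`. -/
def relationBound (ι : Type*) [Fintype ι] (D : ℕ) : ℕ :=
  (Fintype.card ι * D + 1) ^ Fintype.card ι

variable {E : Type*} [AddCommGroup E] [Module ℝ E] {f : M →ₗ[ℤ] E} {u : ι → M}
  {ht : E →ₗ[ℝ] ℝ} {D : ℕ}

/- The combination equals `∑ fract (c i) • u i`, whose height is bounded independently of `c`. -/
theorem exists_bounded_combination_eq_neg_floor (hu : GeneratesConePoints f u)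
    (hht : ∀ i, ht (f (u i)) ∈ Set.Icc 1 (D : ℝ)) {c : ι → ℝ}
    (hc : Fintype.linearCombination ℝ (f ∘ u) c = 0) :
    ∃ a : ι → ℕ, (∀ i, a i ≤ Fintype.card ι * D) ∧
      ∑ i, a i • u i = -Fintype.linearCombination ℤ u fun i => ⌊c i⌋ := by
  have hc' : Fintype.linearCombination ℝ (f ∘ u) c = f 0 := hc.trans (map_zero f).symm
  obtain ⟨a, ha⟩ := AddSubmonoid.mem_closure_range_iff_of_fintype.1 (hu.sub_floor_mem_closure hc')
  have hfract : ∑ i, Int.fract (c i) • f (u i) = f (∑ i, a i • u i) :=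
    ha ▸ linearCombination_fract hc'
  refine ⟨a, fun i => ?_, by rw [← ha, zero_sub]⟩
  have hle : (a i : ℝ) ≤ Fintype.card ι * D := calc
    (a i : ℝ) ≤ ∑ k, (a k : ℝ) := Finset.single_le_sum (fun k _ => (a k).cast_nonneg) (by simp)
    _ ≤ ∑ k, a k * ht (f (u k)) :=
      Finset.sum_le_sum fun k _ => le_mul_of_one_le_right (a k).cast_nonneg (hht k).1
    _ = ht (f (∑ k, a k • u k)) := by simp
    _ = ∑ k, Int.fract (c k) * ht (f (u k)) := by simp [← hfract]
    _ ≤ ∑ _k : ι, (D : ℝ) := Finset.sum_le_sum fun k _ =>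
      (mul_le_of_le_one_left (zero_le_one.trans (hht k).1) (Int.fract_lt_one _).le).trans (hht k).2
    _ = Fintype.card ι * D := by simp
  exact_mod_cast hle

theorem abs_floor_sub_floor_le {R : Type*} [Ring R] [LinearOrder R] [IsStrictOrderedRing R]
    [FloorRing R] {x y : R} {n : ℕ} (h : |x - y| ≤ n) : |⌊x⌋ - ⌊y⌋| ≤ n := by
  obtain ⟨hxy, hyx⟩ := abs_sub_le_iff.1 h
  rw [abs_sub_le_iff, sub_le_iff_le_add', sub_le_iff_le_add', ← Int.floor_add_natCast,
    ← Int.floor_add_natCast]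
  exact ⟨Int.floor_mono (sub_le_iff_le_add'.1 hxy), Int.floor_mono (sub_le_iff_le_add'.1 hyx)⟩

theorem exists_mem_boundedRelations_of_relation (hu : GeneratesConePoints f u)
    (hht : ∀ i, ht (f (u i)) ∈ Set.Icc 1 (D : ℝ)) {c : ι → ℝ}
    (hc : Fintype.linearCombination ℝ (f ∘ u) c = 0) (hc1 : ∀ i, |c i| ≤ 1) {j : ι}
    (hj : c j = 1) :
    ∃ p ∈ boundedRelations (relationBound ι D) u, p j ≠ 0 ∧ ∀ i, c i = 0 → p i = 0 := by
  classical
  choose a ha hau using fun k : ℕ =>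
    exists_bounded_combination_eq_neg_floor hu hht (c := (k : ℝ) • c)
      (by rw [map_smul, hc, smul_zero])
  obtain ⟨k, l, hkl, heq⟩ := Fintype.exists_ne_map_eq_of_card_lt
    (fun (k : Fin (relationBound ι D + 1)) i =>
      (⟨a k i, Nat.lt_succ_of_le (ha k i)⟩ : Fin (Fintype.card ι * D + 1)))
    (by rw [Fintype.card_fun, Fintype.card_fin, Fintype.card_fin]; exact Nat.lt_succ_self _)
  have hakl : a k = a l := funext fun i => congrArg Fin.val (congrFun heq i)
  refine ⟨(fun i => ⌊(k : ℝ) * c i⌋) - fun i => ⌊(l : ℝ) * c i⌋, ⟨fun i => ?_, ?_⟩, ?_, ?_⟩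
  · refine abs_floor_sub_floor_le ?_
    rw [← sub_mul, abs_mul]
    refine (mul_le_of_le_one_right (abs_nonneg _) (hc1 i)).trans ?_
    exact abs_sub_le_of_nonneg_of_le k.1.cast_nonneg (Nat.cast_le.2 (Nat.lt_succ_iff.1 k.2))
      l.1.cast_nonneg (Nat.cast_le.2 (Nat.lt_succ_iff.1 l.2))
  · rw [map_sub, sub_eq_zero, ← neg_inj]
    exact (hau k).symm.trans (hakl ▸ hau l)
  · simpa [hj, sub_eq_zero, Fin.val_inj] using hkl
  · intro i hi
    simp [hi]

theorem span_boundedRelations (hu : GeneratesConePoints f u)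
    (hht : ∀ i, ht (f (u i)) ∈ Set.Icc 1 (D : ℝ)) :
    Submodule.span ℝ ((fun p i => (p i : ℝ)) '' boundedRelations (relationBound ι D) u) =
      (Fintype.linearCombination ℝ (f ∘ u)).ker := by
  set K := (Fintype.linearCombination ℝ (f ∘ u)).ker with hK
  have hpK : ∀ p : ι → ℤ, Fintype.linearCombination ℤ u p = 0 → (fun i => (p i : ℝ)) ∈ K :=
    fun p hp => by rw [hK, LinearMap.mem_ker, linearCombination_intCast, hp, map_zero]
  refine le_antisymm (Submodule.span_le.2 ?_) fun x hx =>
    Submodule.span_le.2 ?_ (mem_span_isElementaryVector hx)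
  · rintro _ ⟨p, hp, rfl⟩
    exact hpK p hp.2
  · intro c hc
    obtain ⟨i, hi⟩ := Function.ne_iff.1 hc.1.2
    obtain ⟨j, -, hmax⟩ := Finset.exists_max_image Finset.univ (fun k => |c k|) ⟨i, by simp⟩
    have hj : c j ≠ 0 := abs_pos.1 ((abs_pos.2 hi).trans_le (hmax i (by simp)))
    obtain ⟨p, hp, hpj, hpc⟩ := exists_mem_boundedRelations_of_relation hu hht
      (c := (c j)⁻¹ • c) (K.smul_mem _ hc.1.1)
      (fun k => by simpa [abs_mul, inv_mul_eq_div, abs_div] using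
        div_le_one_of_le₀ (hmax k (by simp)) (abs_nonneg _)) (j := j) (by simp [hj])
    have hpc' : (Function.support fun k => (p k : ℝ)) ⊆ Function.support c :=
      fun k hk hck => hk (by simp [hpc k (by simp [hck])])
    have hpjc : (p j : ℝ) / c j ≠ 0 := div_ne_zero (Int.cast_ne_zero.2 hpj) hj
    refine (Submodule.smul_mem_iff _ hpjc).1 ?_
    rw [← hc.eq_smul (hpK p hp.2) hpc' hj]
    exact Submodule.subset_span ⟨p, hp, rfl⟩

theorem ker_linearCombination_eq_of_boundedRelations_eq (hf : Function.Injective f) {u' : ι → M}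
    {ht' : E →ₗ[ℝ] ℝ} (hu : GeneratesConePoints f u) (hu' : GeneratesConePoints f u')
    (hht : ∀ i, ht (f (u i)) ∈ Set.Icc 1 (D : ℝ)) (hht' : ∀ i, ht' (f (u' i)) ∈ Set.Icc 1 (D : ℝ))
    (h : boundedRelations (relationBound ι D) u =
      boundedRelations (relationBound ι D) u') :
    (Fintype.linearCombination ℤ u).ker = (Fintype.linearCombination ℤ u').ker := by
  have hreal : (Fintype.linearCombination ℝ (f ∘ u)).ker =
      (Fintype.linearCombination ℝ (f ∘ u')).ker := by
    rw [← span_boundedRelations hu hht, ← span_boundedRelations hu' hht', h]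
  ext p
  simpa only [LinearMap.mem_ker, linearCombination_intCast, map_eq_zero_iff f hf] using
    SetLike.ext_iff.1 hreal fun i => (p i : ℝ)

end BoundedRelations

section Extension

variable {R M : Type*} [CommRing R] [AddCommGroup M] [Module R M]

theorem exists_linearEquiv_prod_quotient (P : Submodule R M) [Module.Projective R (M ⧸ P)] :
    ∃ e : M ≃ₗ[R] P × (M ⧸ P), ∀ x : P, e x = (x, 0) := by
  obtain ⟨s, hs⟩ := P.mkQ.exists_rightInverse_of_surjective P.range_mkQ
  obtain ⟨e, he, -⟩ := (LinearMap.exact_subtype_mkQ P).splitSurjectiveEquiv P.subtype_injective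
    ⟨s, hs⟩
  exact ⟨e, fun x => (e.symm_apply_eq.1 (LinearMap.congr_fun he x).symm).symm⟩

theorem exists_linearEquiv_comp_eq {S E : Type*} [CommRing S] [Algebra R S] [AddCommGroup E]
    [Module R E] [Module S E] [IsScalarTower R S E] {f : M →ₗ[R] E} (hf : IsBaseChange S f)
    (φ : M ≃ₗ[R] M) : ∃ e : E ≃ₗ[S] E, ∀ z, e (f z) = f (φ z) :=
  ⟨hf.equiv.symm ≪≫ₗ φ.baseChange R S M M ≪≫ₗ hf.equiv, fun z => by
    simp [hf.equiv_symm_apply, hf.equiv_tmul]⟩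

variable [IsDomain R] [IsPrincipalIdealRing R] [Module.Finite R M]

theorem exists_linearEquiv_extending {P P' : Submodule R M} [Module.IsTorsionFree R (M ⧸ P)]
    [Module.IsTorsionFree R (M ⧸ P')] (ψ : P ≃ₗ[R] P') :
    ∃ φ : M ≃ₗ[R] M, ∀ x : P, φ x = ψ x := by
  obtain ⟨e, he⟩ := exists_linearEquiv_prod_quotient P
  obtain ⟨e', he'⟩ := exists_linearEquiv_prod_quotient P'
  have hrank : Module.finrank R (M ⧸ P) = Module.finrank R (M ⧸ P') := by
    have h := P.finrank_quotient_add_finrank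
    rw [← P'.finrank_quotient_add_finrank, ψ.finrank_eq] at h
    exact Nat.add_right_cancel h
  refine ⟨e ≪≫ₗ ψ.prodCongr (LinearEquiv.ofFinrankEq _ _ hrank) ≪≫ₗ e'.symm, fun x => ?_⟩
  simp [he, ← he']

theorem exists_linearEquiv_of_ker_linearCombination_eq {ι : Type*} [Fintype ι] {u u' : ι → M}
    [Module.IsTorsionFree R (M ⧸ Submodule.span R (Set.range u))]
    [Module.IsTorsionFree R (M ⧸ Submodule.span R (Set.range u'))]
    (h : (Fintype.linearCombination R u).ker = (Fintype.linearCombination R u').ker) :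
    ∃ φ : M ≃ₗ[R] M, ∀ i, φ (u i) = u' i := by
  classical
  rw [← Fintype.range_linearCombination] at *
  obtain ⟨φ, hφ⟩ := exists_linearEquiv_extending
    ((Fintype.linearCombination R u).quotKerEquivRange.symm ≪≫ₗ
      Submodule.quotEquivOfEq _ _ h ≪≫ₗ (Fintype.linearCombination R u').quotKerEquivRange)
  refine ⟨φ, fun i => ?_⟩
  simpa using hφ ((Fintype.linearCombination R u).quotKerEquivRange
    (Submodule.Quotient.mk (Pi.single i 1)))

end Extension

section IntegerLattice

variable {d : ℕ}

/-- The embedding of `ℤ^d` into `ℝ^d` as a `ℤ`-linear map. Its range is `integerLattice d`. -/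
def intEmbedding (d : ℕ) : (Fin d → ℤ) →ₗ[ℤ] (Fin d → ℝ) :=
  (Algebra.linearMap ℤ ℝ).compLeft (Fin d)

theorem intEmbedding_injective (d : ℕ) : Function.Injective (intEmbedding d) :=
  Int.cast_injective.comp_left

theorem isBaseChange_intEmbedding (d : ℕ) : IsBaseChange ℝ (intEmbedding d) :=
  (IsBaseChange.linearMap ℤ ℝ).finitePow (Fin d)

theorem mem_integerLattice_iff {x : Fin d → ℝ} :
    x ∈ integerLattice d ↔ x ∈ Set.range (intEmbedding d) :=
  Iff.rfl

theorem integrallyEquivalent_of_ker_eq {ι : Type*} [Fintype ι] {u u' : ι → Fin d → ℤ}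
    (hu : GeneratesConePoints (intEmbedding d) u) (hu' : GeneratesConePoints (intEmbedding d) u')
    (h : (Fintype.linearCombination ℤ u).ker = (Fintype.linearCombination ℤ u').ker) :
    IntegrallyEquivalent (hull ℝ (Set.range (intEmbedding d ∘ u)))
      (hull ℝ (Set.range (intEmbedding d ∘ u'))) := by
  have := hu.isTorsionFree_quotient_span
  have := hu'.isTorsionFree_quotient_span
  obtain ⟨φ, hφ⟩ := exists_linearEquiv_of_ker_linearCombination_eq h
  obtain ⟨e, he⟩ := exists_linearEquiv_comp_eq (isBaseChange_intEmbedding d) φ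
  refine ⟨e, ?_, ?_⟩
  · change e '' Set.range (intEmbedding d) = Set.range (intEmbedding d)
    rw [← Set.range_comp, ← φ.surjective.range_comp (intEmbedding d)]
    exact congrArg Set.range (funext he)
  · have hv : e ∘ intEmbedding d ∘ u = intEmbedding d ∘ u' := funext fun i => by simp [he, hφ]
    rw [← hv, Set.range_comp e]
    exact congrArg SetLike.coe (Submodule.map_span
      ((e : (Fin d → ℝ) →ₗ[ℝ] (Fin d → ℝ)).restrictScalars {c : ℝ // 0 ≤ c}) _)

theorem exists_finite_representatives (d m D : ℕ) :
    ∃ F : Set (PointedCone ℝ (Fin d → ℝ)), F.Finite ∧ ∀ u : Fin m → Fin d → ℤ,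
      GeneratesConePoints (intEmbedding d) u →
      (∃ ht : (Fin d → ℝ) →ₗ[ℝ] ℝ, ∀ i, ht (intEmbedding d (u i)) ∈ Set.Icc 1 (D : ℝ)) →
      ∃ τ ∈ F, IntegrallyEquivalent (hull ℝ (Set.range (intEmbedding d ∘ u))) τ := by
  set S := {u : Fin m → Fin d → ℤ | GeneratesConePoints (intEmbedding d) u ∧
    ∃ ht : (Fin d → ℝ) →ₗ[ℝ] ℝ, ∀ i, ht (intEmbedding d (u i)) ∈ Set.Icc 1 (D : ℝ)}
  set g : (Fin m → Fin d → ℤ) → Set (Fin m → ℤ) :=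
    boundedRelations (relationBound (Fin m) D)
  obtain ⟨T, hTS, hT⟩ := Set.exists_subset_bijOn S g
  have hTfin : T.Finite := hT.finite_iff_finite.2
    ((finite_range_boundedRelations _).subset (Set.image_subset_range _ _))
  refine ⟨(fun u => hull ℝ (Set.range (intEmbedding d ∘ u))) '' T, hTfin.image _, ?_⟩
  rintro u hu ⟨ht, hht⟩
  obtain ⟨u', hu'T, hg⟩ := hT.surjOn (Set.mem_image_of_mem g ⟨hu, ht, hht⟩)
  obtain ⟨hu', ht', hht'⟩ := hTS hu'T
  exact ⟨_, Set.mem_image_of_mem _ hu'T, integrallyEquivalent_of_ker_eq hu hu'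
    (ker_linearCombination_eq_of_boundedRelations_eq (intEmbedding_injective d) hu hu' hht hht'
      hg.symm)⟩

theorem exists_isPrimitive_nsmul_eq {x : Fin d → ℝ} (hx : x ∈ integerLattice d) (hx0 : x ≠ 0) :
    ∃ w, IsPrimitive w ∧ ∃ k : ℕ, k ≠ 0 ∧ k • w = x := by
  obtain ⟨z, rfl⟩ := mem_integerLattice_iff.1 hx
  obtain ⟨i, -⟩ := Function.ne_iff.1 hx0
  obtain ⟨y, hzy, hy⟩ := Finset.univ.extract_gcd z ⟨i, Finset.mem_univ i⟩
  have hz : Int.natAbs (Finset.univ.gcd z) • intEmbedding d y = intEmbedding d z := by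
    rw [← map_nsmul]
    congr 1
    ext i
    rw [hzy i (Finset.mem_univ i)]
    have : 0 ≤ Finset.univ.gcd z := Int.nonneg_of_normalize_eq_self Finset.normalize_gcd
    simp [abs_of_nonneg this]
  refine ⟨intEmbedding d y, ⟨⟨y, rfl⟩, fun h0 => hx0 ?_, ?_⟩, _, fun h0 => hx0 ?_, hz⟩
  · rw [← hz, h0, smul_zero]
  · rintro _ ⟨w, rfl⟩ k hk
    obtain rfl : y = k • w := intEmbedding_injective d (by rw [hk, map_nsmul]; rfl)
    have hdvd : (k : ℤ) ∣ 1 := hy ▸ Finset.dvd_gcd fun i _ => ⟨w i, by simp⟩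
    exact Nat.dvd_one.1 (Int.natCast_dvd_natCast.1 hdvd)
  · rw [← hz, h0, zero_smul]

end IntegerLattice

section QGorenstein

variable {d n : ℕ} {σ : PointedCone ℝ (Fin d → ℝ)} {ht : (Fin d → ℝ) →ₗ[ℝ] ℝ} {x : Fin d → ℝ}

theorem primitiveGenerators_subset_latticeMonoid : primitiveGenerators σ ⊆ latticeMonoid σ :=
  fun _ hv => ⟨hv.2.le (subset_hull rfl), hv.1.1⟩

theorem hull_primitiveGenerators (hσ : IsPointedRational σ) :
    hull ℝ (primitiveGenerators σ) = σ := by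
  refine le_antisymm
    (Submodule.span_le.2 fun v hv => (primitiveGenerators_subset_latticeMonoid hv).1) ?_
  obtain ⟨⟨s, hs, rfl⟩, hsal⟩ := hσ
  obtain ⟨t, hts, ht, hface⟩ := exists_subset_hull_eq_and_isFaceOf s.finite_toSet hsal
  refine ht.ge.trans (Submodule.span_le.2 fun a ha => ?_)
  obtain ⟨ha0, haface⟩ := hface a ha
  obtain ⟨w, hw, k, hk, rfl⟩ := exists_isPrimitive_nsmul_eq (hs (hts ha)) ha0
  have hray : hull ℝ {k • w} = hull ℝ {w} := by
    rw [← Nat.cast_smul_eq_nsmul ℝ, hull_singleton_smul (Nat.cast_pos.2 hk.bot_lt)]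
  have hw_mem : w ∈ primitiveGenerators (hull ℝ (s : Set (Fin d → ℝ))) := ⟨hw, hray ▸ haface⟩
  exact nsmul_mem (subset_hull hw_mem) k

/- Otherwise the `n + 1` lattice points `0 • x, …, n • x` would all lie in the nib. -/
theorem one_lt_mul_height (hσ : IsPointedRational σ) (hht : ∀ v ∈ primitiveGenerators σ, ht v = 1)
    (hn : (nib σ ∩ integerLattice d).encard ≤ n) (hx : x ∈ latticeMonoid σ) (hx0 : x ≠ 0) :
    1 < n * ht x := by
  rw [← hull_primitiveGenerators hσ] at hx
  by_contra! hle
  have hpos : 0 < ht x := height_pos_of_mem_hull hht hx.1 hx0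
  have hsub : (fun k : ℕ => k • x) '' Set.Iic n ⊆ nib σ ∩ integerLattice d := by
    rintro _ ⟨k, hk, rfl⟩
    refine ⟨mem_convexHull_of_height_le_one hht (nsmul_mem hx.1 k) ?_, nsmul_mem hx.2 k⟩
    calc ht (k • x) = k * ht x := by rw [map_nsmul, nsmul_eq_mul]
      _ ≤ n * ht x := by gcongr; exact hk
      _ ≤ 1 := hle
  have hinj : Function.Injective fun k : ℕ => k • x := fun k l hkl => by
    simpa [← Nat.cast_smul_eq_nsmul ℝ, hx0] using hkl
  have hcard := (Set.encard_le_encard hsub).trans hn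
  rw [hinj.encard_image, ← Finset.coe_Iic, Set.encard_coe_eq_coe_finsetCard, Nat.card_Iic] at hcard
  exact n.lt_irrefl (Nat.cast_le.1 hcard)

theorem height_le_card_of_mem_hilbertBasis [Fintype (primitiveGenerators σ)]
    (hσ : IsPointedRational σ) (hht : ∀ v ∈ primitiveGenerators σ, ht v = 1)
    (hx : x ∈ hilbertBasis σ) : ht x ≤ Fintype.card (primitiveGenerators σ) := by
  have hrange : hull ℝ (Set.range ((↑) : primitiveGenerators σ → Fin d → ℝ)) = σ := by
    rw [Subtype.range_coe, hull_primitiveGenerators hσ]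
  obtain hle | ⟨v, hv⟩ := height_le_card_or_exists_sub_mem_hull
    (v := ((↑) : primitiveGenerators σ → Fin d → ℝ)) (fun v => hht v v.2) (hrange.ge hx.1.1)
  · exact hle
  have hvσ := primitiveGenerators_subset_latticeMonoid v.2
  have hsub : x - v ∈ latticeMonoid σ := 
    ⟨hrange.le hv, (integerLattice d).sub_mem hx.1.2 hvσ.2⟩
  obtain hv0 | hxv := hx.2.2 v hvσ (x - v) hsub (add_sub_cancel _ _).symm
  · exact absurd hv0 v.2.1.2.1
  · rw [sub_eq_zero.1 hxv, hht v v.2, Nat.one_le_cast]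
    exact Fintype.card_pos_iff.2 ⟨v⟩

theorem exists_height_bounds (hσ : IsQGorenstein σ)
    (hn : (nib σ ∩ integerLattice d).encard ≤ n) :
    ∃ ht : (Fin d → ℝ) →ₗ[ℝ] ℝ, (∀ x ∈ latticeMonoid σ, x ≠ 0 → 1 ≤ ht x) ∧
      ∀ x ∈ hilbertBasis σ, ht x ≤ (n * n : ℕ) := by
  obtain ⟨hσ, ht, hht⟩ := hσ
  have hsub : primitiveGenerators σ ⊆ nib σ ∩ integerLattice d := fun v hv =>
    ⟨subset_convexHull ℝ _ (Set.mem_insert_of_mem _ hv), hv.1.1⟩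
  have hcard : (primitiveGenerators σ).encard ≤ n := (Set.encard_le_encard hsub).trans hn
  have := (Set.finite_of_encard_le_coe hcard).fintype
  rw [← Set.coe_fintypeCard, Nat.cast_le] at hcard
  refine ⟨(n : ℝ) • ht, fun x hx hx0 => (one_lt_mul_height hσ hht hn hx hx0).le, fun x hx => ?_⟩
  rw [Nat.cast_mul]
  exact mul_le_mul_of_nonneg_left ((height_le_card_of_mem_hilbertBasis hσ hht hx).trans
    (Nat.cast_le.2 hcard)) n.cast_nonneg

theorem hull_hilbertBasis (hσ : IsPointedRational σ)
    (hcl : AddSubmonoid.closure (hilbertBasis σ) = latticeMonoid σ) :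
    hull ℝ (hilbertBasis σ) = σ := by
  refine le_antisymm (Submodule.span_le.2 fun x hx => hx.1.1) ?_
  have hle : latticeMonoid σ ≤ (hull ℝ (hilbertBasis σ)).toAddSubmonoid :=
    hcl ▸ AddSubmonoid.closure_le.2 subset_hull
  conv_lhs => rw [← hull_primitiveGenerators hσ]
  exact Submodule.span_le.2 (primitiveGenerators_subset_latticeMonoid.trans hle)

theorem generatesConePoints_of_range_eq_hilbertBasis {ι : Type*} {u : ι → Fin d → ℤ}
    (hσ : IsPointedRational σ)
    (hcl : AddSubmonoid.closure (hilbertBasis σ) = latticeMonoid σ)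
    (hu : Set.range (intEmbedding d ∘ u) = hilbertBasis σ) :
    GeneratesConePoints (intEmbedding d) u := by
  intro z hz
  rw [hu, hull_hilbertBasis hσ hcl] at hz
  have hmem : intEmbedding d z ∈ latticeMonoid σ := ⟨hz, z, rfl⟩
  rw [← hcl, ← hu, Set.range_comp] at hmem
  rw [← AddSubmonoid.mem_map_iff_mem (f := (intEmbedding d).toAddMonoidHom)
    (intEmbedding_injective d), AddMonoidHom.map_mclosure]
  exact hmem

theorem exists_range_intEmbedding_comp_eq {s : Set (Fin d → ℝ)} (hs : s ⊆ integerLattice d)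
    (hn : s.encard ≤ n) : ∃ m ≤ n, ∃ u : Fin m → Fin d → ℤ,
      Set.range (intEmbedding d ∘ u) = s := by
  obtain ⟨m, v, hv, rfl⟩ := (Set.finite_of_encard_le_coe hn).fin_param
  obtain ⟨u, hu⟩ := Set.range_subset_range_iff_exists_comp.1 hs
  refine ⟨m, ?_, u, congrArg Set.range hu.symm⟩
  simpa [← Set.image_univ, hv.encard_image] using hn

theorem exists_bounded_generators (hσ : IsQGorenstein σ)
    (hn : (hilbertBasis σ).encard + (nib σ ∩ integerLattice d).encard ≤ n) :
    ∃ m ≤ n, ∃ u : Fin m → Fin d → ℤ, hull ℝ (Set.range (intEmbedding d ∘ u)) = σ ∧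
      GeneratesConePoints (intEmbedding d) u ∧
      ∃ ht : (Fin d → ℝ) →ₗ[ℝ] ℝ, ∀ i, ht (intEmbedding d (u i)) ∈ Set.Icc 1 ((n * n : ℕ) : ℝ) := by
  obtain ⟨ht, hlow, hupp⟩ := exists_height_bounds hσ (le_add_self.trans hn)
  have hcl : AddSubmonoid.closure (hilbertBasis σ) = latticeMonoid σ :=
    closure_indecomposables (ht := ht.toAddMonoidHom) hlow
  obtain ⟨m, hm, u, hu⟩ :=
    exists_range_intEmbedding_comp_eq (fun x hx => hx.1.2) (le_self_add.trans hn)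
  refine ⟨m, hm, u, hu ▸ hull_hilbertBasis hσ.1 hcl,
    generatesConePoints_of_range_eq_hilbertBasis hσ.1 hcl hu, ht, fun i => ?_⟩
  have hui : intEmbedding d (u i) ∈ hilbertBasis σ := hu ▸ Set.mem_range_self i
  exact ⟨hlow _ hui.1 hui.2.1, hupp _ hui⟩

end QGorenstein

end LatticeCone

theorem mainTheorem7 (N d : ℕ) :
    ∃ F : Set (PointedCone ℝ (Fin d → ℝ)), F.Finite ∧
      ∀ σ : PointedCone ℝ (Fin d → ℝ), LatticeCone.IsQGorenstein σ →
        (LatticeCone.hilbertBasis σ).encard +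
            (LatticeCone.nib σ ∩ (LatticeCone.integerLattice d : Set (Fin d → ℝ))).encard
          ≤ (N : ℕ∞) + 1 →
        ∃ τ ∈ F, LatticeCone.IntegrallyEquivalent σ τ := by
  choose F hF hrep using fun m =>
    LatticeCone.exists_finite_representatives d m ((N + 1) * (N + 1))
  refine ⟨⋃ m ∈ Set.Iic (N + 1), F m, (Set.finite_Iic _).biUnion fun m _ => hF m, ?_⟩
  intro σ hσ hN
  obtain ⟨m, hm, u, rfl, hu, hheight⟩ :=
    LatticeCone.exists_bounded_generators (n := N + 1) hσ (by exact_mod_cast hN)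
  obtain ⟨τ, hτ, hequiv⟩ := hrep m u hu hheight
  exact ⟨τ, Set.mem_biUnion (Set.mem_Iic.2 hm) hτ, hequiv⟩
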